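/- Let $C\subset\mathbb{P}^2$ be a reduced plane curve of degree $d$ over $\mathbb{C}$, and let $P_0$ be a point of $C$ of maximal multiplicity $m_0$ (so $m_0=1$, with $P_0$ any point of $C$, if $C$ is smooth). Suppose that $d=m_0+1$. Then: (1) $C$ consists of $\ell\ge 0$ distinct lines through $P_0$ together with an irreducible curve $C'$ of degree $d'=d-\ell\geq 1$ which has multiplicity exactly $d'-1$ at $P_0$ (so $P_0\notin C'$ if $d'=1$), and every point of $C'$ other than $P_0$ is a non-singular point of $C'$; (2) $C$ is Cremona contractible, i.e., there is a birational map $\gamma\colon\mathbb{P}^2\dashrightarrow\mathbb{P}^2$ which contracts each irreducible component of $C$ to a point (it is constant on the points of the component at which it is defined). -/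

import Mathlib

open MvPolynomial

namespace PlaneCremona

/-- The complex projective plane. -/
abbrev P2 : Type := Projectivization ℂ (Fin 3 → ℂ)

/-- The ring of homogeneous coordinates of the plane. A plane curve of degree `d` is given by a
nonzero form of degree `d`; it is reduced when the form is squarefree, and its irreducible
components are the irreducible factors of the form. -/
abbrev CoordRing : Type := MvPolynomial (Fin 3) ℂ

/-- The point `P` lies on the curve `F = 0` (for a form `F` the representative is irrelevant). -/
def LiesOn (P : P2) (F : CoordRing) : Prop := eval P.rep F = 0

/-- The Taylor expansion `F(v + X)` of `F` at the vector `v`. -/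
noncomputable def taylorAt (F : CoordRing) (v : Fin 3 → ℂ) : CoordRing :=
  aeval (fun i => X i + C (v i)) F

/-- The multiplicity at `P` of the plane curve `F = 0`: the order of vanishing of the form `F` at
a vector `v` representing `P`, i.e. the least degree of a monomial of `F(v + X)`. As `F` is
homogeneous, this does not depend on `v`, and it equals the order of vanishing at `P` of a
dehomogenization of `F`, since the affine cone over the curve is, near `v`, the product of the
curve with a line. It is `⊤` only for `F = 0`. -/
noncomputable def multAt (F : CoordRing) (P : P2) : ℕ∞ :=
  MvPowerSeries.order (taylorAt F P.rep : MvPowerSeries (Fin 3) ℂ)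

/-- A Cremona transformation of the plane: a birational map of the plane to itself. It is written,
as every rational map from the plane to itself, as `[f₀, f₁, f₂]` with forms `fᵢ` of the same
degree and without common factor; it comes with a rational inverse `[g₀, g₁, g₂]`, both composites
being the identity as rational maps. -/
structure CremonaMap where
  toForms : Fin 3 → CoordRing
  invForms : Fin 3 → CoordRing
  degree : ℕ
  invDegree : ℕ
  isHomogeneous : ∀ i, (toForms i).IsHomogeneous degree
  inv_isHomogeneous : ∀ i, (invForms i).IsHomogeneous invDegree
  noCommonFactor : ∀ p : CoordRing, (∀ i, p ∣ toForms i) → IsUnit p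
  inv_noCommonFactor : ∀ p : CoordRing, (∀ i, p ∣ invForms i) → IsUnit p
  inv_comp : ∃ h : CoordRing, h ≠ 0 ∧ ∀ i, bind₁ toForms (invForms i) = h * X i
  comp_inv : ∃ h : CoordRing, h ≠ 0 ∧ ∀ i, bind₁ invForms (toForms i) = h * X i

/-- The homogeneous coordinates of the image of `P`. As the forms have no common factor, the
transformation is defined at `P` exactly when this vector is nonzero. -/
noncomputable def CremonaMap.coords (φ : CremonaMap) (P : P2) : Fin 3 → ℂ :=
  fun i => eval P.rep (φ.toForms i)

/-- `φ` contracts the irreducible curve `G = 0` to a point: it is constant on the curve, wherever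
it is defined. (It is undefined at finitely many points only.) -/
def CremonaMap.Contracts (φ : CremonaMap) (G : CoordRing) : Prop :=
  ∃ q : P2, ∀ P : P2, LiesOn P G →
    ∀ h : φ.coords P ≠ 0, Projectivization.mk ℂ (φ.coords P) h = q

/-- The reduced plane curve `F = 0` is Cremona contractible: some Cremona transformation contracts
each of its irreducible components to a point. -/
def IsCrContractible (F : CoordRing) : Prop :=
  ∃ φ : CremonaMap, ∀ G : CoordRing, Irreducible G → G ∣ F → φ.Contracts G

end PlaneCremona

open PlaneCremona

/-! Move `P₀` to `[1 : 0 : 0]`. The coefficient of `X₀ ^ i` in a form of degree `m₀ + 1` is a form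
of degree `m₀ + 1 - i` in `X₁, X₂`, so multiplicity at least `m₀` leaves only `F = a X₀ + b`
(`exists_eq_biform`), and exact multiplicity gives `a ≠ 0`.

For (1), common zeros of `a` and `b` on the projective line are lines through `P₀`. Splitting them
off (`exists_prod_mul_eq`) leaves `a' X₀ + b'` with no common zero. It is irreducible, being linear
in `X₀` with coprime coefficients, and has multiplicity `deg a'` at `P₀`. At any other of its points
`a' ≠ 0`, since otherwise `b'` would vanish too; hence the `X₀`-derivative is nonzero and the point
is smooth.

For (2), `[h : X₁ F : X₂ F]` with `h` prime to `a` is birational (`pencilMap`) and sends all of `F =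
0`, where defined, to `[1 : 0 : 0]`. -/

namespace PlaneCremona

/-! ### Linear substitutions and orders of vanishing -/

/-- The substitution of linear forms `F ↦ F(T X)` given by a matrix `T`. -/
noncomputable def lin (T : Matrix (Fin 3) (Fin 3) ℂ) : CoordRing →ₐ[ℂ] CoordRing :=
  aeval fun i => ∑ j, C (T i j) * X j

theorem lin_X (T : Matrix (Fin 3) (Fin 3) ℂ) (i : Fin 3) :
    lin T (X i) = ∑ j, C (T i j) * X j := by
  simp [lin]

theorem lin_lin (S T : Matrix (Fin 3) (Fin 3) ℂ) (F : CoordRing) :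
    lin S (lin T F) = lin (T * S) F := by
  have : (lin S).comp (lin T) = lin (T * S) := by
    ext1 i
    simp only [AlgHom.comp_apply, lin_X, map_sum, map_mul, algHom_C, algebraMap_eq,
      Matrix.mul_apply, Finset.mul_sum, Finset.sum_mul]
    rw [Finset.sum_comm]
    simp [mul_assoc]
  exact DFunLike.congr_fun this F

theorem lin_one (F : CoordRing) : lin 1 F = F := by
  have : lin 1 = AlgHom.id ℂ CoordRing := by
    ext1 i
    simp [lin_X, Matrix.one_apply]
  exact DFunLike.congr_fun this F

theorem eval_lin (T : Matrix (Fin 3) (Fin 3) ℂ) (F : CoordRing) (w : Fin 3 → ℂ) :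
    eval w (lin T F) = eval (T.mulVec w) F := by
  have : (aeval w).comp (lin T) = (aeval (T.mulVec w) : CoordRing →ₐ[ℂ] ℂ) := by
    ext1 i
    simp [lin_X, Matrix.mulVec, dotProduct]
  simpa [coe_aeval_eq_eval] using DFunLike.congr_fun this F

theorem taylorAt_lin (T : Matrix (Fin 3) (Fin 3) ℂ) (F : CoordRing) (w : Fin 3 → ℂ) :
    taylorAt (lin T F) w = lin T (taylorAt F (T.mulVec w)) := by
  have : (aeval (fun i => X i + C (w i)) : CoordRing →ₐ[ℂ] CoordRing).comp (lin T) =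
      (lin T).comp (aeval fun i => X i + C (T.mulVec w i)) := by
    ext1 i
    simp [lin_X, Matrix.mulVec, dotProduct, mul_add, Finset.sum_add_distrib, algHom_C]
  exact DFunLike.congr_fun this F

theorem isHomogeneous_lin_X (T : Matrix (Fin 3) (Fin 3) ℂ) (i : Fin 3) :
    (∑ j, C (T i j) * X j : CoordRing).IsHomogeneous 1 :=
  IsHomogeneous.sum _ _ _ fun _ _ => isHomogeneous_C_mul_X _ _

theorem isHomogeneous_lin (T : Matrix (Fin 3) (Fin 3) ℂ) {F : CoordRing} {d : ℕ}
    (hF : F.IsHomogeneous d) : (lin T F).IsHomogeneous d := by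
  simpa [lin] using hF.aeval _ (isHomogeneous_lin_X T)

theorem homogeneousComponent_lin (T : Matrix (Fin 3) (Fin 3) ℂ) (F : CoordRing) (k : ℕ) :
    homogeneousComponent k (lin T F) = lin T (homogeneousComponent k F) := by
  conv_lhs => rw [← sum_homogeneousComponent F]
  rw [map_sum, map_sum]
  have h (i : ℕ) : homogeneousComponent k (lin T (homogeneousComponent i F)) =
      if i = k then lin T (homogeneousComponent k F) else 0 := by
    rw [homogeneousComponent_of_mem (n := i)
      (isHomogeneous_lin T (homogeneousComponent_isHomogeneous i F))]
    by_cases hik : i = k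
    · simp [hik]
    · simp [hik, Ne.symm hik]
  simp only [h]
  by_cases hk : k < F.totalDegree + 1
  · simp [hk]
  · rw [homogeneousComponent_eq_zero k F (by lia)]
    simp

theorem le_order_iff {F : CoordRing} {n : ℕ} :
    (n : ℕ∞) ≤ MvPowerSeries.order (F : MvPowerSeries (Fin 3) ℂ) ↔
      ∀ k < n, homogeneousComponent k F = 0 := by
  constructor
  · intro h k hk
    ext m
    rw [coeff_homogeneousComponent]
    split_ifs with hm
    · rw [← coeff_coe]
      rw [MvPowerSeries.coeff_of_lt_order]
      · simp
      · exact lt_of_lt_of_le (by exact_mod_cast hm ▸ hk) h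
    · simp
  · intro h
    refine MvPowerSeries.nat_le_order fun m hm => ?_
    have := congrArg (coeff m) (h _ hm)
    rw [coeff_homogeneousComponent] at this
    simpa using this

/-- Invertibility is not needed; singular diagonal matrices will later serve as restrictions to
coordinate subspaces. -/
theorem order_le_order_lin (T : Matrix (Fin 3) (Fin 3) ℂ) (F : CoordRing) :
    MvPowerSeries.order (F : MvPowerSeries (Fin 3) ℂ) ≤
      MvPowerSeries.order (lin T F : MvPowerSeries (Fin 3) ℂ) := by
  refine ENat.forall_natCast_le_iff_le.mp fun n hn => ?_
  rw [le_order_iff] at hn ⊢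
  intro k hk
  rw [homogeneousComponent_lin, hn k hk, map_zero]

theorem order_lin {T T' : Matrix (Fin 3) (Fin 3) ℂ} (h : T * T' = 1) (F : CoordRing) :
    MvPowerSeries.order (lin T F : MvPowerSeries (Fin 3) ℂ) =
      MvPowerSeries.order (F : MvPowerSeries (Fin 3) ℂ) := by
  refine le_antisymm ?_ (order_le_order_lin T F)
  have := order_le_order_lin T' (lin T F)
  rwa [lin_lin, h, lin_one] at this

theorem order_taylorAt_lin {T T' : Matrix (Fin 3) (Fin 3) ℂ} (h : T * T' = 1) (F : CoordRing)
    (w : Fin 3 → ℂ) :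
    MvPowerSeries.order (taylorAt (lin T F) w : MvPowerSeries (Fin 3) ℂ) =
      MvPowerSeries.order (taylorAt F (T.mulVec w) : MvPowerSeries (Fin 3) ℂ) := by
  rw [taylorAt_lin, order_lin h]

/-- Some invertible matrix sends the first basis vector to a given nonzero vector. -/
theorem exists_matrix_mulVec_eq {v : Fin 3 → ℂ} (hv : v ≠ 0) :
    ∃ T T' : Matrix (Fin 3) (Fin 3) ℂ, T * T' = 1 ∧ T' * T = 1 ∧
      T.mulVec (Pi.single 0 1) = v := by
  obtain ⟨A, hA⟩ := SeparatingDual.exists_continuousLinearEquiv_apply_eq (R := ℂ)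
    (x := (Pi.single 0 1 : Fin 3 → ℂ)) (y := v) (by simp) hv
  refine ⟨LinearMap.toMatrix' A.toLinearEquiv.toLinearMap,
    LinearMap.toMatrix' A.symm.toLinearEquiv.toLinearMap, ?_, ?_, ?_⟩
  · rw [← LinearMap.toMatrix'_comp, ← LinearMap.toMatrix'_id]
    congr 1
    ext; simp
  · rw [← LinearMap.toMatrix'_comp, ← LinearMap.toMatrix'_id]
    congr 1
    ext; simp
  · rw [LinearMap.toMatrix'_mulVec]
    simpa using hA

theorem sum_mul_sum_of_mul_eq_one {T T' : Matrix (Fin 3) (Fin 3) ℂ} (h : T * T' = 1)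
    (f : Fin 3 → CoordRing) (i : Fin 3) :
    ∑ j, C (T i j) * ∑ k, C (T' j k) * f k = f i := by
  simp_rw [Finset.mul_sum]
  rw [Finset.sum_comm]
  simp_rw [← mul_assoc, ← C_mul, ← Finset.sum_mul, ← map_sum, ← Matrix.mul_apply, h]
  simp [Matrix.one_apply]

/-! ### Linear change of coordinates in a Cremona map -/

/-- Precomposition of a Cremona transformation with a linear one. -/
noncomputable def CremonaMap.precompLin (φ : CremonaMap) (T T' : Matrix (Fin 3) (Fin 3) ℂ)
    (h : T * T' = 1) (h' : T' * T = 1) : CremonaMap where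
  toForms i := lin T (φ.toForms i)
  invForms i := ∑ j, C (T' i j) * φ.invForms j
  degree := φ.degree
  invDegree := φ.invDegree
  isHomogeneous i := isHomogeneous_lin T (φ.isHomogeneous i)
  inv_isHomogeneous i := IsHomogeneous.sum _ _ _ fun j _ => (φ.inv_isHomogeneous j).C_mul _
  noCommonFactor p hp := by
    have h1 : IsUnit (lin T' p) := φ.noCommonFactor _ fun i => by
      have := map_dvd (lin T') (hp i)
      rwa [lin_lin, h, lin_one] at this
    have := h1.map (lin T)
    rwa [lin_lin, h', lin_one] at this
  inv_noCommonFactor p hp := by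
    refine φ.inv_noCommonFactor p fun i => ?_
    rw [← sum_mul_sum_of_mul_eq_one h φ.invForms i]
    exact Finset.dvd_sum fun j _ => (hp j).mul_left _
  inv_comp := by
    obtain ⟨q, hq, hq'⟩ := φ.inv_comp
    refine ⟨lin T q, fun h0 => hq ?_, fun i => ?_⟩
    · have := congrArg (lin T') h0
      rwa [lin_lin, h, lin_one, map_zero] at this
    · have key : bind₁ (fun i => lin T (φ.toForms i)) = (lin T).comp (bind₁ φ.toForms) := by
        ext1 i; simp
      rw [key]
      simp only [AlgHom.comp_apply, map_sum, map_mul, hq', algHom_C, algebraMap_eq, lin_X]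
      simp_rw [mul_left_comm _ (lin T q), ← Finset.mul_sum]
      rw [sum_mul_sum_of_mul_eq_one h']
  comp_inv := by
    obtain ⟨q, hq, hq'⟩ := φ.comp_inv
    refine ⟨q, hq, fun i => ?_⟩
    have key : (bind₁ fun i => ∑ j, C (T' i j) * φ.invForms j).comp (lin T) =
        bind₁ φ.invForms := by
      ext1 i
      simp only [AlgHom.comp_apply, lin_X, map_sum, map_mul, algHom_C, algebraMap_eq,
        bind₁_X_right]
      exact sum_mul_sum_of_mul_eq_one h φ.invForms i
    rw [← hq' i, ← key]
    rfl

/-! ### Forms of degree at most one in `X₀` -/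

/-- The inclusion of the polynomials in the last two coordinates; a form in its image defines a
union of lines through `[1 : 0 : 0]`. -/
noncomputable abbrev cone : MvPolynomial (Fin 2) ℂ →ₐ[ℂ] CoordRing := rename Fin.succ

/-- The polynomial `a(X₁, X₂) X₀ + b(X₁, X₂)`. -/
noncomputable def biform (a b : MvPolynomial (Fin 2) ℂ) : CoordRing := cone a * X 0 + cone b

theorem cone_injective : Function.Injective cone := rename_injective _ (Fin.succ_injective 2)

theorem eval_cone (w : Fin 3 → ℂ) (a : MvPolynomial (Fin 2) ℂ) :
    eval w (cone a) = eval (Fin.tail w) a := by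
  rw [eval_rename]
  rfl

theorem isHomogeneous_cone {a : MvPolynomial (Fin 2) ℂ} {n : ℕ} (ha : a.IsHomogeneous n) :
    (cone a).IsHomogeneous n :=
  ha.rename_isHomogeneous

theorem isHomogeneous_biform {a b : MvPolynomial (Fin 2) ℂ} {n : ℕ} (ha : a.IsHomogeneous n)
    (hb : b.IsHomogeneous (n + 1)) : (biform a b).IsHomogeneous (n + 1) :=
  ((isHomogeneous_cone ha).mul (isHomogeneous_X _ _)).add (isHomogeneous_cone hb)

theorem taylorAt_cone (a : MvPolynomial (Fin 2) ℂ) : taylorAt (cone a) (Pi.single 0 1) = cone a := by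
  have : (aeval fun i => X i + C ((Pi.single 0 1 : Fin 3 → ℂ) i)).comp cone = cone := by
    ext1 i
    simp
  exact DFunLike.congr_fun this a

theorem taylorAt_biform (a b : MvPolynomial (Fin 2) ℂ) :
    taylorAt (biform a b) (Pi.single 0 1) = biform a b + cone a := by
  have h : taylorAt (biform a b) (Pi.single 0 1) =
      taylorAt (cone a) (Pi.single 0 1) * (X 0 + 1) + taylorAt (cone b) (Pi.single 0 1) := by
    simp [taylorAt, biform]
  rw [h, taylorAt_cone, taylorAt_cone, biform]
  ring

theorem order_taylorAt_biform {a b : MvPolynomial (Fin 2) ℂ} {n : ℕ} (ha : a.IsHomogeneous n)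
    (hb : b.IsHomogeneous (n + 1)) (ha0 : a ≠ 0) :
    MvPowerSeries.order (taylorAt (biform a b) (Pi.single 0 1) : MvPowerSeries (Fin 3) ℂ) = n := by
  have hc (k : ℕ) : homogeneousComponent k (taylorAt (biform a b) (Pi.single 0 1)) =
      (if k = n + 1 then biform a b else 0) + if k = n then cone a else 0 := by
    rw [taylorAt_biform, map_add, homogeneousComponent_of_mem (isHomogeneous_biform ha hb),
      homogeneousComponent_of_mem (isHomogeneous_cone ha)]
  refine le_antisymm (not_lt.mp fun hlt => ?_) (le_order_iff.mpr fun k hk => ?_)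
  · have h := le_order_iff.mp (Order.add_one_le_of_lt hlt : ((n + 1 : ℕ) : ℕ∞) ≤ _) n (by lia)
    rw [hc] at h
    simp only [left_eq_add, one_ne_zero, if_false, if_true, zero_add] at h
    exact ha0 (cone_injective (h.trans (map_zero cone).symm))
  · rw [hc, if_neg (by lia), if_neg (by lia), add_zero]

/-- Translating by the first basis vector and then killing `X₀` amounts to setting `X₀ = 1`, that
is, to dehomogenizing. -/
theorem lin_taylorAt_eq_cone (F : CoordRing) :
    lin (Matrix.diagonal ![0, 1, 1]) (taylorAt F (Pi.single 0 1)) =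
      cone ((finSuccEquiv ℂ 2 F).eval 1) := by
  have : (lin (Matrix.diagonal ![0, 1, 1])).comp
      (aeval fun i => X i + C ((Pi.single 0 1 : Fin 3 → ℂ) i)) =
      cone.comp (((Polynomial.aeval (1 : MvPolynomial (Fin 2) ℂ)).restrictScalars ℂ).comp
        (finSuccEquiv ℂ 2).toAlgHom) := by
    ext1 i
    fin_cases i
    · simp [lin_X, Matrix.diagonal_apply, finSuccEquiv_X_zero]
    · have := finSuccEquiv_X_succ (R := ℂ) (n := 2) (j := 0)
      simp at this
      simp [lin_X, Matrix.diagonal_apply, this]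
    · have := finSuccEquiv_X_succ (R := ℂ) (n := 2) (j := 1)
      simp at this
      simp [lin_X, Matrix.diagonal_apply, this]
  refine (DFunLike.congr_fun this F).trans ?_
  simp

theorem finSuccEquiv_cone (c : MvPolynomial (Fin 2) ℂ) :
    finSuccEquiv ℂ 2 (cone c) = Polynomial.C c := by
  have : (finSuccEquiv ℂ 2).toAlgHom.comp cone =
      (IsScalarTower.toAlgHom ℂ (MvPolynomial (Fin 2) ℂ) (Polynomial (MvPolynomial (Fin 2) ℂ))) := by
    ext1 i
    simpa using finSuccEquiv_X_succ (R := ℂ) (j := i)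
  exact DFunLike.congr_fun this c

/-- After setting `X₀ = 1`, the coefficient of `X₀ ^ i` becomes the homogeneous component of degree
`n + 1 - i`. Order at least `n` kills it for `i ≥ 2`. -/
theorem exists_eq_biform {F : CoordRing} {n : ℕ} (hF : F.IsHomogeneous (n + 1))
    (h : (n : ℕ∞) ≤ MvPowerSeries.order (taylorAt F (Pi.single 0 1) : MvPowerSeries (Fin 3) ℂ)) :
    ∃ a b, a.IsHomogeneous n ∧ b.IsHomogeneous (n + 1) ∧ F = biform a b := by
  set f := finSuccEquiv ℂ 2 F with hf
  have hcoeff (i j : ℕ) (hij : i + j = n + 1) : (f.coeff i).IsHomogeneous j :=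
    hF.finSuccEquiv_coeff_isHomogeneous i j hij
  have hdeg : f.natDegree ≤ n + 1 := by
    rw [hf, natDegree_finSuccEquiv]
    exact (degreeOf_le_totalDegree F 0).trans hF.totalDegree_le
  have hzero (k : ℕ) (hk : k < n) : f.coeff (n + 1 - k) = 0 := by
    have h1 := le_order_iff.mp (h.trans (order_le_order_lin (Matrix.diagonal ![0, 1, 1]) _)) k hk
    rw [lin_taylorAt_eq_cone, ← rename_homogeneousComponent, ← hf,
      Polynomial.eval_eq_sum_range' (n := n + 2) (by lia), map_sum] at h1
    replace h1 := cone_injective (h1.trans (map_zero cone).symm)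
    rw [Finset.sum_eq_single (n + 1 - k)] at h1
    · rwa [one_pow, mul_one, homogeneousComponent_of_mem (hcoeff _ k (by lia)), if_pos rfl] at h1
    · intro i hi hik
      rw [Finset.mem_range] at hi
      rw [one_pow, mul_one, homogeneousComponent_of_mem (hcoeff i (n + 1 - i) (by lia)),
        if_neg (by lia)]
    · intro hi
      exact absurd (Finset.mem_range.mpr (by lia)) hi
  have hlin : f.natDegree ≤ 1 := by
    rw [Polynomial.natDegree_le_iff_coeff_eq_zero]
    intro i hi
    by_cases hin : i ≤ n + 1
    · simpa [show n + 1 - (n + 1 - i) = i by lia] using hzero (n + 1 - i) (by lia)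
    · exact Polynomial.coeff_eq_zero_of_natDegree_lt (by lia)
  refine ⟨f.coeff 1, f.coeff 0, hcoeff _ _ (by lia), hcoeff _ _ (by lia), ?_⟩
  apply (finSuccEquiv ℂ 2).injective
  rw [biform, map_add, map_mul, finSuccEquiv_cone, finSuccEquiv_cone, finSuccEquiv_X_zero, ← hf]
  exact Polynomial.eq_X_add_C_of_natDegree_le_one hlin

theorem ne_zero_of_order_taylorAt_biform {a b : MvPolynomial (Fin 2) ℂ} {n : ℕ}
    (hb : b.IsHomogeneous (n + 1))
    (h : MvPowerSeries.order (taylorAt (biform a b) (Pi.single 0 1) : MvPowerSeries (Fin 3) ℂ) = n) :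
    a ≠ 0 := by
  rintro rfl
  have : ((n + 1 : ℕ) : ℕ∞) ≤ n := by
    rw [← h, le_order_iff]
    intro k hk
    rw [taylorAt_biform]
    simp [biform, homogeneousComponent_of_mem (isHomogeneous_cone hb), hk.ne]
  exact absurd (by exact_mod_cast this) (Nat.not_succ_le_self n)

/-- Along the line through `w` in the `X₀` direction the expansion is `a(w) X₀`, so the order is at
most one; vanishing at `w` makes it at least one. -/
theorem order_taylorAt_biform_of_eval_ne_zero {a b : MvPolynomial (Fin 2) ℂ} {w : Fin 3 → ℂ}
    (hw : eval w (biform a b) = 0) (ha : eval (Fin.tail w) a ≠ 0) :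
    MvPowerSeries.order (taylorAt (biform a b) w : MvPowerSeries (Fin 3) ℂ) = 1 := by
  apply le_antisymm
  · refine (order_le_order_lin (Matrix.diagonal ![1, 0, 0]) _).trans ?_
    have hcone (c : MvPolynomial (Fin 2) ℂ) :
        lin (Matrix.diagonal ![1, 0, 0]) (taylorAt (cone c) w) = C (eval (Fin.tail w) c) := by
      have : ((lin (Matrix.diagonal ![1, 0, 0])).comp (aeval fun i => X i + C (w i))).comp cone =
          (Algebra.ofId ℂ CoordRing).comp (aeval (Fin.tail w)) := by
        ext1 i
        fin_cases i <;>
          simp [lin_X, Matrix.diagonal_apply, algHom_C, Fin.tail,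
            Algebra.ofId_apply]
      refine (DFunLike.congr_fun this c).trans ?_
      simp [Algebra.ofId_apply]
    have key : lin (Matrix.diagonal ![1, 0, 0]) (taylorAt (biform a b) w) =
        C (eval (Fin.tail w) a) * X 0 := by
      have h1 : taylorAt (biform a b) w =
          taylorAt (cone a) w * (X 0 + C (w 0)) + taylorAt (cone b) w := by
        simp [taylorAt, biform]
      rw [biform, map_add, map_mul, eval_cone, eval_cone, eval_X] at hw
      rw [h1, map_add, map_mul, hcone, hcone, map_add, lin_X, mul_add, add_assoc, algHom_C,
        algebraMap_eq, ← C_mul, ← C_add, hw]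
      simp [Matrix.diagonal_apply]
    rw [key]
    refine (MvPowerSeries.order_le (d := Finsupp.single 0 1) ?_).trans (by simp)
    rw [coeff_coe, coeff_C_mul]
    simpa using ha
  · refine le_order_iff (n := 1).mpr fun k hk => ?_
    obtain rfl : k = 0 := by lia
    rw [homogeneousComponent_zero]
    have : coeff 0 (taylorAt (biform a b) w) = eval w (biform a b) := by
      have : (aeval (0 : Fin 3 → ℂ) : CoordRing →ₐ[ℂ] ℂ).comp (aeval fun i => X i + C (w i)) =
          aeval w := by
        ext1 i
        simp
      have h2 := DFunLike.congr_fun this (biform a b)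
      rw [← constantCoeff_eq]
      simpa [coe_aeval_eq_eval, taylorAt] using h2
    rw [this, hw, map_zero]

/-! ### Binary forms and their common zeros -/

theorem aeval_mul_of_isHomogeneous {σ A : Type*} [CommRing A] [Algebra ℂ A]
    {f : MvPolynomial σ ℂ} {n : ℕ} (hf : f.IsHomogeneous n) (r : A) (g : σ → A) :
    aeval (fun i => r * g i) f = r ^ n * aeval g f := by
  rw [aeval_def, aeval_def, eval₂_eq, eval₂_eq, Finset.mul_sum]
  refine Finset.sum_congr rfl fun m hm => ?_
  simp_rw [mul_pow, Finset.prod_mul_distrib, Finset.prod_pow_eq_pow_sum]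
  rw [hf.degree_eq_sum_deg_support hm]
  ring

theorem isHomogeneous_of_mul {σ : Type*} {f g : MvPolynomial σ ℂ} {m n : ℕ}
    (hf : f.IsHomogeneous m) (hf0 : f ≠ 0) (hfg : (f * g).IsHomogeneous (m + n)) :
    g.IsHomogeneous n := by
  have h : f * g = f * homogeneousComponent n g := by
    have h1 : homogeneousComponent (m + n) (f * g) = f * homogeneousComponent n g := by
      conv_lhs => rw [← sum_homogeneousComponent g]
      rw [Finset.mul_sum, map_sum]
      have hc (i : ℕ) : homogeneousComponent (m + n) (f * homogeneousComponent i g) =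
          if i = n then f * homogeneousComponent n g else 0 := by
        rw [homogeneousComponent_of_mem (hf.mul (homogeneousComponent_isHomogeneous i g))]
        by_cases hin : i = n
        · simp [hin]
        · rw [if_neg (by lia), if_neg hin]
      simp only [hc]
      by_cases hk : n < g.totalDegree + 1
      · simp [hk]
      · rw [homogeneousComponent_eq_zero n g (by lia)]
        simp
    rw [← h1, homogeneousComponent_of_mem hfg, if_pos rfl]
  rw [mul_left_cancel₀ hf0 h]
  exact homogeneousComponent_isHomogeneous n g

/-- A form in two variables defining the point `[w₀ : w₁]` of the projective line. -/
noncomputable def pointForm (w : Fin 2 → ℂ) : MvPolynomial (Fin 2) ℂ :=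
  C (w 1) * X 0 + C (-w 0) * X 1

theorem isHomogeneous_pointForm (w : Fin 2 → ℂ) : (pointForm w).IsHomogeneous 1 :=
  (isHomogeneous_C_mul_X _ _).add (isHomogeneous_C_mul_X _ _)

theorem eval_pointForm (w u : Fin 2 → ℂ) : eval u (pointForm w) = w 1 * u 0 - w 0 * u 1 := by
  simp [pointForm, sub_eq_add_neg]

theorem pointForm_ne_zero {w : Fin 2 → ℂ} (hw : w ≠ 0) : pointForm w ≠ 0 := by
  intro h
  apply hw
  have h0 := eval_pointForm w (Pi.single 0 1)
  have h1 := eval_pointForm w (Pi.single 1 1)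
  rw [h] at h0 h1
  ext i
  fin_cases i
  · simpa using h1
  · simpa using h0.symm

theorem irreducible_pointForm {w : Fin 2 → ℂ} (hw : w ≠ 0) : Irreducible (pointForm w) := by
  have h0 := pointForm_ne_zero hw
  refine irreducible_of_totalDegree_eq_one ((isHomogeneous_pointForm w).totalDegree h0)
    fun x hx => isUnit_iff_ne_zero.mpr ?_
  rintro rfl
  exact h0 (MvPolynomial.ext _ _ fun m => by simpa using hx m)

/-- The Nullstellensatz for a principal ideal. -/
theorem dvd_of_zeroLocus_subset {σ : Type*} [Finite σ] {p f : MvPolynomial σ ℂ}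
    (h : ∀ x, eval x p = 0 → eval x f = 0) : ∃ n : ℕ, p ∣ f ^ n := by
  have : f ∈ (Ideal.span {p}).radical := by
    rw [← vanishingIdeal_zeroLocus_eq_radical (K := ℂ)]
    intro x hx
    rw [aeval_eq_eval]
    refine h x ?_
    simpa [aeval_eq_eval] using hx p (Ideal.mem_span_singleton_self p)
  obtain ⟨n, hn⟩ := this
  exact ⟨n, Ideal.mem_span_singleton.mp hn⟩

/-- The zeros of `pointForm w` are the multiples of `w`, where `f` vanishes by homogeneity; the
Nullstellensatz and primality conclude. -/
theorem pointForm_dvd {f : MvPolynomial (Fin 2) ℂ} {n : ℕ} (hf : f.IsHomogeneous n)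
    {w : Fin 2 → ℂ} (hw : w ≠ 0) (h : eval w f = 0) : pointForm w ∣ f := by
  obtain ⟨k, hk⟩ := dvd_of_zeroLocus_subset (p := pointForm w) (f := f) fun x hx => by
    rw [eval_pointForm, sub_eq_zero] at hx
    obtain ⟨t, ht⟩ : ∃ t : ℂ, x = fun i => t * w i := by
      by_cases h0 : w 0 = 0
      · have h1 : w 1 ≠ 0 := fun h1 => hw (by ext i; fin_cases i <;> assumption)
        refine ⟨x 1 / w 1, ?_⟩
        ext i
        fin_cases i
        · rw [h0, zero_mul] at hx
          simpa [h0, h1] using hx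
        · simp [h1]
      · refine ⟨x 0 / w 0, ?_⟩
        ext i
        fin_cases i
        · simp [h0]
        · simp only [Fin.mk_one]
          field_simp
          linear_combination -hx
    have := aeval_mul_of_isHomogeneous hf t w
    rw [aeval_eq_eval, aeval_eq_eval] at this
    simpa [ht, h] using this
  exact (irreducible_pointForm hw).prime.dvd_of_dvd_pow hk

theorem isRelPrime_X_X : IsRelPrime (X 0 : MvPolynomial (Fin 2) ℂ) (X 1) := by
  rw [(MvPolynomial.X_prime (i := 0)).irreducible.isRelPrime_iff_not_dvd, X_dvd_X]
  simp

/-- With no zero outside the origin, `p` would divide powers of both `X 0` and `X 1`, which are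
coprime. -/
theorem exists_eval_eq_zero_of_not_isUnit {p : MvPolynomial (Fin 2) ℂ} (hp : ¬ IsUnit p) :
    ∃ w ≠ 0, eval w p = 0 := by
  by_contra! h
  have hX (i : Fin 2) : ∃ n : ℕ, p ∣ X i ^ n := dvd_of_zeroLocus_subset fun x hx => by
    have : x = 0 := by
      by_contra h0
      exact h x h0 hx
    simp [this]
  obtain ⟨m, hm⟩ := hX 0
  obtain ⟨n, hn⟩ := hX 1
  exact hp (isRelPrime_X_X.pow hm hn)

theorem isRelPrime_of_forall_eval {a b : MvPolynomial (Fin 2) ℂ}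
    (h : ∀ w ≠ 0, eval w a = 0 → eval w b ≠ 0) : IsRelPrime a b := by
  intro p hpa hpb
  by_contra hp
  obtain ⟨w, hw, hpw⟩ := exists_eval_eq_zero_of_not_isUnit hp
  exact h w hw (zero_dvd_iff.mp (hpw ▸ map_dvd (eval w) hpa))
    (zero_dvd_iff.mp (hpw ▸ map_dvd (eval w) hpb))

/-- Two binary forms are the products of a common product of linear forms with two forms
without common zero. -/
theorem exists_prod_mul_eq (n : ℕ) {a b : MvPolynomial (Fin 2) ℂ} (ha : a.IsHomogeneous n)
    (hb : b.IsHomogeneous (n + 1)) (ha0 : a ≠ 0) :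
    ∃ (l k : ℕ) (L : Fin l → MvPolynomial (Fin 2) ℂ) (a' b' : MvPolynomial (Fin 2) ℂ),
      l + k = n ∧ (∀ i, (L i).IsHomogeneous 1) ∧ a'.IsHomogeneous k ∧
      b'.IsHomogeneous (k + 1) ∧ a' ≠ 0 ∧ a = (∏ i, L i) * a' ∧ b = (∏ i, L i) * b' ∧
      ∀ w ≠ 0, eval w a' = 0 → eval w b' ≠ 0 := by
  induction n generalizing a b with
  | zero =>
    refine ⟨0, 0, Fin.elim0, a, b, rfl, fun i => i.elim0, ha, hb, ha0, by simp, by simp, ?_⟩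
    intro w _ haw
    rw [totalDegree_eq_zero_iff_eq_C.mp (Nat.le_zero.mp ha.totalDegree_le), eval_C] at haw
    rw [totalDegree_eq_zero_iff_eq_C.mp (Nat.le_zero.mp ha.totalDegree_le), haw, map_zero] at ha0
    exact absurd rfl ha0
  | succ n ih =>
    by_cases h : ∀ w ≠ 0, eval w a = 0 → eval w b ≠ 0
    · exact ⟨0, n + 1, Fin.elim0, a, b, by simp, fun i => i.elim0, ha, hb, ha0, by simp,
        by simp, h⟩
    · push Not at h
      obtain ⟨w, hw, haw, hbw⟩ := h
      obtain ⟨a₁, rfl⟩ := pointForm_dvd ha hw haw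
      obtain ⟨b₁, rfl⟩ := pointForm_dvd hb hw hbw
      have hw0 := pointForm_ne_zero hw
      obtain ⟨l, k, L, a', b', hlk, hL, ha', hb', ha0', rfl, rfl, h'⟩ :=
        ih (isHomogeneous_of_mul (isHomogeneous_pointForm w) hw0 (by rwa [add_comm 1 n]))
          (isHomogeneous_of_mul (isHomogeneous_pointForm w) hw0 (by rwa [add_comm 1 (n + 1)]))
          (right_ne_zero_of_mul ha0)
      refine ⟨l + 1, k, Fin.cons (pointForm w) L, a', b', by lia, ?_, ha', hb', ha0', ?_, ?_, h'⟩
      · intro i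
        cases i using Fin.cases with
        | zero => exact isHomogeneous_pointForm w
        | succ i => exact hL i
      · simp [Fin.prod_univ_succ, mul_assoc]
      · simp [Fin.prod_univ_succ, mul_assoc]

/-! ### Irreducibility and divisibility, viewing polynomials in `X₀` -/

theorem finSuccEquiv_biform (a b : MvPolynomial (Fin 2) ℂ) :
    finSuccEquiv ℂ 2 (biform a b) = Polynomial.C a * Polynomial.X + Polynomial.C b := by
  rw [biform, map_add, map_mul, finSuccEquiv_cone, finSuccEquiv_cone, finSuccEquiv_X_zero]

theorem cone_ne_zero {a : MvPolynomial (Fin 2) ℂ} (ha : a ≠ 0) : cone a ≠ 0 :=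
  (map_ne_zero_iff cone cone_injective).mpr ha

theorem biform_ne_zero {a b : MvPolynomial (Fin 2) ℂ} (ha : a ≠ 0) : biform a b ≠ 0 := by
  intro h
  have := congrArg (fun f => (finSuccEquiv ℂ 2 f).coeff 1) h
  simp only [finSuccEquiv_biform] at this
  exact ha (by simpa using this)

theorem irreducible_biform {a b : MvPolynomial (Fin 2) ℂ} (ha : a ≠ 0) (hab : IsRelPrime a b) :
    Irreducible (biform a b) := by
  rw [← MulEquiv.irreducible_iff (finSuccEquiv ℂ 2), finSuccEquiv_biform]
  exact Polynomial.irreducible_C_mul_X_add_C ha hab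

theorem exists_eq_cone_of_dvd {p : CoordRing} {c : MvPolynomial (Fin 2) ℂ} (hc : c ≠ 0)
    (h : p ∣ cone c) : ∃ q, p = cone q := by
  have h1 := map_dvd (finSuccEquiv ℂ 2) h
  rw [finSuccEquiv_cone] at h1
  have h2 := Polynomial.natDegree_le_of_dvd h1 (by simpa using hc)
  rw [Polynomial.natDegree_C, Nat.le_zero] at h2
  refine ⟨(finSuccEquiv ℂ 2 p).coeff 0, (finSuccEquiv ℂ 2).injective ?_⟩
  rw [finSuccEquiv_cone]
  exact Polynomial.eq_C_of_natDegree_eq_zero h2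

theorem dvd_of_cone_dvd_biform {p a b : MvPolynomial (Fin 2) ℂ} (h : cone p ∣ biform a b) :
    p ∣ a ∧ p ∣ b := by
  have h1 := map_dvd (finSuccEquiv ℂ 2) h
  rw [finSuccEquiv_cone, finSuccEquiv_biform, Polynomial.C_dvd_iff_dvd_coeff] at h1
  exact ⟨by simpa using h1 1, by simpa using h1 0⟩

theorem dvd_of_cone_dvd_cone {p a : MvPolynomial (Fin 2) ℂ} (h : cone p ∣ cone a) : p ∣ a :=
  (dvd_of_cone_dvd_biform (a := 0) (by simpa [biform] using h)).2

theorem isUnit_of_dvd_cone {p : CoordRing} {a b : MvPolynomial (Fin 2) ℂ} (ha : a ≠ 0)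
    (hab : IsRelPrime a b) (hpa : p ∣ cone a) (hpb : p ∣ cone b) : IsUnit p := by
  obtain ⟨q, rfl⟩ := exists_eq_cone_of_dvd ha hpa
  exact (hab (dvd_of_cone_dvd_cone hpa) (dvd_of_cone_dvd_cone hpb)).map cone

theorem isUnit_of_dvd_biform {p : CoordRing} {a b c : MvPolynomial (Fin 2) ℂ} (hc : c ≠ 0)
    (hpc : p ∣ cone c) (h : p ∣ biform a b) (hcab : ∀ q, q ∣ c → q ∣ a → q ∣ b → IsUnit q) :
    IsUnit p := by
  obtain ⟨q, rfl⟩ := exists_eq_cone_of_dvd hc hpc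
  obtain ⟨hqa, hqb⟩ := dvd_of_cone_dvd_biform h
  exact (hcab q (dvd_of_cone_dvd_cone hpc) hqa hqb).map cone

theorem dvd_of_dvd_X_mul {p f : CoordRing} (hp : Irreducible p) (h1 : p ∣ X 1 * f)
    (h2 : p ∣ X 2 * f) : p ∣ f := by
  by_contra hf
  refine hp.not_isUnit (isUnit_of_dvd_cone (X_ne_zero 0) isRelPrime_X_X ?_ ?_)
  · simpa using (hp.prime.dvd_or_dvd h1).resolve_right hf
  · simpa using (hp.prime.dvd_or_dvd h2).resolve_right hf

/-! ### Cremona maps preserving the pencil of lines -/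

theorem bind₁_cone {c : MvPolynomial (Fin 2) ℂ} {k : ℕ} (hc : c.IsHomogeneous k)
    {f : Fin 3 → CoordRing} {r : CoordRing} (h1 : f 1 = r * X 1) (h2 : f 2 = r * X 2) :
    bind₁ f (cone c) = r ^ k * cone c := by
  have hf : f ∘ Fin.succ = fun i => r * X i.succ := by
    ext1 i
    fin_cases i
    · exact h1
    · exact h2
  rw [bind₁_rename, hf, bind₁, aeval_mul_of_isHomogeneous hc, cone, rename_eq_aeval]
  rfl

theorem exists_isRelPrime_isHomogeneous {a : MvPolynomial (Fin 2) ℂ} (ha : a ≠ 0) (n : ℕ) :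
    ∃ h : MvPolynomial (Fin 2) ℂ, h ≠ 0 ∧ h.IsHomogeneous n ∧ IsRelPrime a h := by
  -- The factor `X 0` only forces `w ≠ 0`.
  obtain ⟨w, hw⟩ : ∃ w, eval w (a * X 0) ≠ 0 := by
    by_contra! h
    exact mul_ne_zero ha (X_ne_zero 0) (MvPolynomial.funext fun w => by rw [h, map_zero])
  rw [map_mul, eval_X] at hw
  have hw0 : w ≠ 0 := by
    rintro rfl
    simp at hw
  refine ⟨pointForm w ^ n, pow_ne_zero _ (pointForm_ne_zero hw0),
    by simpa using (isHomogeneous_pointForm w).pow n, IsRelPrime.pow_right ?_⟩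
  rw [isRelPrime_comm, (irreducible_pointForm hw0).isRelPrime_iff_not_dvd]
  intro hdvd
  refine left_ne_zero_of_mul hw (zero_dvd_iff.mp ?_)
  have := map_dvd (eval w) hdvd
  rwa [eval_pointForm, mul_comm, sub_self] at this

/-- The Cremona transformation `[h : X₁ F : X₂ F]` for `F = a X₀ + b` and a form `h(X₁, X₂)`
prime to `a`; it preserves the pencil of lines through `[1 : 0 : 0]`. -/
noncomputable def pencilMap {n : ℕ} {a b h : MvPolynomial (Fin 2) ℂ} (ha : a.IsHomogeneous n)
    (hb : b.IsHomogeneous (n + 1)) (ha0 : a ≠ 0) (hh : h.IsHomogeneous (n + 2)) (hh0 : h ≠ 0)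
    (hah : IsRelPrime a h) : CremonaMap where
  toForms := ![cone h, X 1 * biform a b, X 2 * biform a b]
  -- With `X₁, X₂` fixed, the map is the Möbius transformation `X₀ ↦ h / (a X₀ + b)`, with inverse
  -- `X₀ ↦ (h - b X₀) / (a X₀)`.
  invForms := ![biform (-b) h, X 1 * (X 0 * cone a), X 2 * (X 0 * cone a)]
  degree := n + 2
  invDegree := n + 2
  isHomogeneous i := by
    have h (i : Fin 3) : (X i * biform a b).IsHomogeneous (n + 2) := by
      have := (isHomogeneous_X ℂ i).mul (isHomogeneous_biform ha hb)
      rwa [show 1 + (n + 1) = n + 2 by ring] at this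
    fin_cases i
    · exact isHomogeneous_cone hh
    · exact h 1
    · exact h 2
  inv_isHomogeneous i := by
    have h (i : Fin 3) : (X i * (X 0 * cone a)).IsHomogeneous (n + 2) := by
      have := (isHomogeneous_X ℂ i).mul ((isHomogeneous_X ℂ 0).mul (isHomogeneous_cone ha))
      rwa [show 1 + (1 + n) = n + 2 by ring] at this
    fin_cases i
    · exact isHomogeneous_biform hb.neg hh
    · exact h 1
    · exact h 2
  noCommonFactor p hp := by
    have hp0 : p ≠ 0 := fun h0 => cone_ne_zero hh0 (zero_dvd_iff.mp (h0 ▸ hp 0))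
    by_contra hu
    obtain ⟨q, hq, hqp⟩ := WfDvdMonoid.exists_irreducible_factor hu hp0
    exact hq.not_isUnit (isUnit_of_dvd_biform hh0 (hqp.trans (hp 0))
      (dvd_of_dvd_X_mul hq (hqp.trans (hp 1)) (hqp.trans (hp 2))) fun r hrh hra _ => hah hra hrh)
  inv_noCommonFactor p hp := by
    have hp0 : p ≠ 0 := by
      intro h0
      have : (X 1 * (X 0 * cone a) : CoordRing) = 0 := zero_dvd_iff.mp (h0 ▸ hp 1)
      exact mul_ne_zero (X_ne_zero 1) (mul_ne_zero (X_ne_zero 0) (cone_ne_zero ha0)) this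
    by_contra hu
    obtain ⟨q, hq, hqp⟩ := WfDvdMonoid.exists_irreducible_factor hu hp0
    have hq0 : q ∣ biform (-b) h := hqp.trans (hp 0)
    rcases hq.prime.dvd_or_dvd (dvd_of_dvd_X_mul hq (hqp.trans (hp 1)) (hqp.trans (hp 2)))
      with hX | hA
    -- A factor associated to `X₀` would divide `h - b X₀`, hence `h`, which is free of `X₀`.
    · have h1 : X 0 ∣ biform (-b) h :=
        ((hq.associated_of_dvd (MvPolynomial.X_prime (i := 0)).irreducible hX).dvd_iff_dvd_left).mp hq0
      rw [biform, dvd_add_right (dvd_mul_left _ _)] at h1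
      have h2 := map_dvd (finSuccEquiv ℂ 2) h1
      rw [finSuccEquiv_cone, finSuccEquiv_X_zero, Polynomial.X_dvd_iff, Polynomial.coeff_C_zero]
        at h2
      exact hh0 h2
    · exact hq.not_isUnit (isUnit_of_dvd_biform ha0 hA hq0 fun r hra _ hrh => hah hra hrh)
  inv_comp := by
    -- With `F = a X₀ + b`, the first coordinate is `F ^ (n + 1) h (F - b) = F ^ (n + 1) h a X₀`.
    refine ⟨biform a b ^ (n + 1) * cone h * cone a, ?_, ?_⟩
    · exact mul_ne_zero (mul_ne_zero (pow_ne_zero _ (biform_ne_zero ha0)) (cone_ne_zero hh0))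
        (cone_ne_zero ha0)
    · have hc {k : ℕ} {c : MvPolynomial (Fin 2) ℂ} (hc : c.IsHomogeneous k) :
          bind₁ ![cone h, X 1 * biform a b, X 2 * biform a b] (cone c) =
            biform a b ^ k * cone c :=
        bind₁_cone hc (mul_comm _ _) (mul_comm _ _)
      have hX (i : Fin 3) : bind₁ ![cone h, X 1 * biform a b, X 2 * biform a b] (X i) =
          ![cone h, X 1 * biform a b, X 2 * biform a b] i := bind₁_X_right _ _
      intro i
      fin_cases i
      · change bind₁ _ (cone (-b) * X 0 + cone h) = _ * X 0
        rw [map_add, map_mul, hc hb.neg, hc hh, hX]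
        simp only [Matrix.cons_val_zero, map_neg]
        rw [pow_succ _ (n + 1)]
        nth_rw 3 [biform]
        ring
      · change bind₁ _ (X 1 * (X 0 * cone a)) = _ * X 1
        rw [map_mul, map_mul, hc ha, hX, hX]
        simp only [Matrix.cons_val_zero, Matrix.cons_val_one]
        ring
      · change bind₁ _ (X 2 * (X 0 * cone a)) = _ * X 2
        rw [map_mul, map_mul, hc ha, hX, hX]
        simp only [Matrix.cons_val_zero, Matrix.cons_val]
        ring
  comp_inv := by
    refine ⟨(X 0 * cone a) ^ (n + 1) * cone a * cone h, ?_, ?_⟩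
    · exact mul_ne_zero (mul_ne_zero (pow_ne_zero _ (mul_ne_zero (X_ne_zero 0)
        (cone_ne_zero ha0))) (cone_ne_zero ha0)) (cone_ne_zero hh0)
    · have hc {k : ℕ} {c : MvPolynomial (Fin 2) ℂ} (hc : c.IsHomogeneous k) :
          bind₁ ![biform (-b) h, X 1 * (X 0 * cone a), X 2 * (X 0 * cone a)] (cone c) =
            (X 0 * cone a) ^ k * cone c :=
        bind₁_cone hc (mul_comm _ _) (mul_comm _ _)
      have hX (i : Fin 3) :
          bind₁ ![biform (-b) h, X 1 * (X 0 * cone a), X 2 * (X 0 * cone a)] (X i) =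
          ![biform (-b) h, X 1 * (X 0 * cone a), X 2 * (X 0 * cone a)] i := bind₁_X_right _ _
      have hF : bind₁ ![biform (-b) h, X 1 * (X 0 * cone a), X 2 * (X 0 * cone a)] (biform a b) =
          (X 0 * cone a) ^ n * cone a * cone h := by
        nth_rw 2 [biform]
        rw [map_add, map_mul, hc ha, hc hb, hX]
        simp only [Matrix.cons_val_zero]
        rw [biform, map_neg]
        ring
      intro i
      fin_cases i
      · change bind₁ _ (cone h) = _ * X 0
        rw [hc hh]
        ring
      · change bind₁ _ (X 1 * biform a b) = _ * X 1
        rw [map_mul, hF, hX]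
        simp only [Matrix.cons_val_one, Matrix.cons_val_zero]
        ring
      · change bind₁ _ (X 2 * biform a b) = _ * X 2
        rw [map_mul, hF, hX]
        simp only [Matrix.cons_val]
        ring

/-! ### Contraction and conclusion -/

theorem CremonaMap.contracts_of_dvd {φ : CremonaMap} {F G : CoordRing} (hGF : G ∣ F)
    (h1 : F ∣ φ.toForms 1) (h2 : F ∣ φ.toForms 2) : φ.Contracts G := by
  refine ⟨Projectivization.mk ℂ (Pi.single 0 1) (by simp), fun P hP hne => ?_⟩
  have hz {f : CoordRing} (hf : F ∣ f) : eval P.rep f = 0 :=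
    zero_dvd_iff.mp (hP ▸ map_dvd (eval P.rep) (hGF.trans hf))
  rw [Projectivization.mk_eq_mk_iff']
  refine ⟨φ.coords P 0, ?_⟩
  ext i
  fin_cases i
  · simp
  · simpa [CremonaMap.coords] using (hz h1).symm
  · simpa [CremonaMap.coords] using (hz h2).symm

theorem isCrContractible_lin_biform {n : ℕ} {a b : MvPolynomial (Fin 2) ℂ}
    (ha : a.IsHomogeneous n) (hb : b.IsHomogeneous (n + 1)) (ha0 : a ≠ 0)
    {T T' : Matrix (Fin 3) (Fin 3) ℂ} (h : T * T' = 1) (h' : T' * T = 1) :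
    IsCrContractible (lin T (biform a b)) := by
  obtain ⟨f, hf0, hf, haf⟩ := exists_isRelPrime_isHomogeneous ha0 (n + 2)
  exact ⟨(pencilMap ha hb ha0 hf hf0 haf).precompLin T T' h h', fun G _ hGF =>
    CremonaMap.contracts_of_dvd hGF (map_dvd (lin T) (dvd_mul_left _ _))
      (map_dvd (lin T) (dvd_mul_left _ _))⟩

theorem irreducible_lin {T T' : Matrix (Fin 3) (Fin 3) ℂ} (h : T * T' = 1) (h' : T' * T = 1)
    {F : CoordRing} (hF : Irreducible F) : Irreducible (lin T F) := by
  let e : CoordRing ≃ₐ[ℂ] CoordRing := AlgEquiv.ofAlgHom (lin T) (lin T')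
    (by ext1 i; simp [lin_lin, h', lin_one]) (by ext1 i; simp [lin_lin, h, lin_one])
  exact (MulEquiv.irreducible_iff e).mpr hF

theorem eval_tail_ne_zero {a b : MvPolynomial (Fin 2) ℂ}
    (h : ∀ w ≠ 0, eval w a = 0 → eval w b ≠ 0) {w : Fin 3 → ℂ} (hw : Fin.tail w ≠ 0)
    (hwF : eval w (biform a b) = 0) : eval (Fin.tail w) a ≠ 0 := by
  intro h0
  rw [biform, map_add, map_mul, eval_cone, eval_cone, h0, zero_mul, zero_add] at hwF
  exact h _ hw h0 hwF

theorem mul_dvd_prod_mul {ι R : Type*} [Fintype ι] [CommRing R] {i j : ι} (hij : i ≠ j)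
    (f : ι → R) (g : R) : f i * f j ∣ (∏ i, f i) * g := by
  classical
  rw [← Finset.prod_pair (f := f) hij]
  exact (Finset.prod_dvd_prod_of_subset _ _ f (Finset.subset_univ _)).mul_right g

end PlaneCremona

theorem mainTheorem8 (d m₀ : ℕ) (F : CoordRing) (hF : F.IsHomogeneous d) (hred : Squarefree F)
    (P₀ : P2) (hm₀ : multAt F P₀ = (m₀ : ℕ∞)) (hmax : ∀ Q : P2, multAt F Q ≤ (m₀ : ℕ∞))
    (hd : d = m₀ + 1) :
    (∃ (ℓ d' : ℕ) (L : Fin ℓ → CoordRing) (G : CoordRing),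
      F = (∏ i, L i) * G ∧
      ℓ + d' = d ∧
      (∀ i, (L i).IsHomogeneous 1 ∧ LiesOn P₀ (L i)) ∧
      (∀ i j, i ≠ j → ¬ Associated (L i) (L j)) ∧
      G.IsHomogeneous d' ∧ Irreducible G ∧
      multAt G P₀ + 1 = (d' : ℕ∞) ∧
      (∀ Q : P2, Q ≠ P₀ → LiesOn Q G → multAt G Q = 1)) ∧
    IsCrContractible F := by
  subst hd
  obtain ⟨T, T', hTT', hT'T, hTv⟩ := exists_matrix_mulVec_eq P₀.rep_nonzero
  have hT'v : T'.mulVec P₀.rep = Pi.single 0 1 := by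
    rw [← hTv, Matrix.mulVec_mulVec, hT'T, Matrix.one_mulVec]
  have hord : MvPowerSeries.order
      (taylorAt (lin T F) (Pi.single 0 1) : MvPowerSeries (Fin 3) ℂ) = m₀ := by
    rw [order_taylorAt_lin hTT', hTv]
    exact hm₀
  obtain ⟨a, b, ha, hb, hab⟩ := exists_eq_biform (isHomogeneous_lin T hF) hord.ge
  rw [hab] at hord
  have ha0 := ne_zero_of_order_taylorAt_biform hb hord
  obtain rfl : F = lin T' (biform a b) := by rw [← hab, lin_lin, hTT', lin_one]
  refine ⟨?_, isCrContractible_lin_biform ha hb ha0 hT'T hTT'⟩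
  obtain ⟨l, k, L, a', b', hlk, hL, ha', hb', ha0', rfl, rfl, hnz⟩ :=
    exists_prod_mul_eq m₀ ha hb ha0
  have hprod : lin T' (biform ((∏ i, L i) * a') ((∏ i, L i) * b')) =
      (∏ i, lin T' (cone (L i))) * lin T' (biform a' b') := by
    rw [← map_prod, ← map_prod, ← map_mul]
    congr 1
    rw [biform, biform, map_mul, map_mul]
    ring
  have hP₀ (i : Fin l) : eval P₀.rep (lin T' (cone (L i))) = 0 := by
    rw [eval_lin, hT'v, eval_cone]
    have : Fin.tail (Pi.single 0 1 : Fin 3 → ℂ) = 0 := by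
      ext j
      simp [Fin.tail]
    rw [this, eval_zero, constantCoeff_eq]
    exact (hL i).coeff_eq_zero (by simp)
  refine ⟨l, k + 1, fun i => lin T' (cone (L i)), lin T' (biform a' b'), hprod, by lia,
    fun i => ⟨isHomogeneous_lin T' (isHomogeneous_cone (hL i)), hP₀ i⟩, ?_,
    isHomogeneous_lin T' (isHomogeneous_biform ha' hb'),
    irreducible_lin hT'T hTT' (irreducible_biform ha0' (isRelPrime_of_forall_eval hnz)), ?_, ?_⟩
  · intro i j hij hass
    -- Associated lines would put a square into `F`; its root vanishes at `P₀`, so it is not a unit.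
    have hdvd := (mul_dvd_mul_left _ hass.dvd).trans
      (mul_dvd_prod_mul hij (fun i => lin T' (cone (L i))) (lin T' (biform a' b')))
    rw [← hprod] at hdvd
    have := (hred _ hdvd).map (eval P₀.rep)
    rw [hP₀] at this
    exact not_isUnit_zero this
  · rw [multAt, order_taylorAt_lin hT'T, hT'v, order_taylorAt_biform ha' hb' ha0']
    simp
  · intro Q hQ hQG
    rw [LiesOn, eval_lin] at hQG
    rw [multAt, order_taylorAt_lin hT'T]
    refine order_taylorAt_biform_of_eval_ne_zero hQG (eval_tail_ne_zero hnz (fun h0 => hQ ?_) hQG)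
    -- In the new coordinates `Q` has only its first entry nonzero, hence is `P₀`.
    rw [← Q.mk_rep, ← P₀.mk_rep, Projectivization.mk_eq_mk_iff']
    refine ⟨T'.mulVec Q.rep 0, ?_⟩
    have : T'.mulVec Q.rep = T'.mulVec Q.rep 0 • Pi.single 0 1 := by
      ext j
      cases j using Fin.cases with
      | zero => simp
      | succ j => simpa [Fin.tail] using congrFun h0 j
    rw [← hTv, ← Matrix.mulVec_smul, ← this, Matrix.mulVec_mulVec, hTT', Matrix.one_mulVec]
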